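/- Let $K$ be an infinite field, let $E = K((X,Y)) = \operatorname{Quot}(K[[X,Y]])$, and let $v$ be the discrete valuation of $E$ extending the order function of the maximal ideal $\langle X,Y\rangle$ of $K[[X,Y]]$. Let $I$ be a finite set and let $c_i \in K$ ($i \in I$) be pairwise distinct; put $z_i = \frac{Y}{X - c_iY} \in E$. For each $J \subseteq I$ let $D_J$ be the completion with respect to $v$ of the subring $K[z_k \mid k \in J][X,Y]$ of $E$; all these rings, and $E$, are viewed as subrings of the completion $\hat E$ of $E$ with respect to $v$ (so $D_J$ is the closure of $K[z_k \mid k\in J][X,Y]$ in $\hat E$). For each $i \in I$ let $Q_i = E\cdot D_{I\smallsetminus\{i\}}$ be the subring of $\hat E$ generated by $E$ and $D_{I\smallsetminus\{i\}}$. Fix $J \subseteq I$ and $j \in J$, and put $t = X - c_jY$. Let $K[[t]] \subseteq K[[X,Y]]$ be the ring of power series in $t$ over $K$ and $K((t)) \subseteq E$ its field of fractions. Then: (a) For each $0 \neq g \in D_J$, $D_J[t^{-1}] = K((t))[z_k \mid k \in J] + g\,D_J[t^{-1}]$. (b) For each $f \in D_J$ there exist $p \in K[[t]][z_j]$ and $u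 \in D_J^\times$ such that $f = pu$. (c) The ring $Q_j$ is a field. -/

import Mathlib

open scoped WithZero Pointwise

noncomputable section

namespace AnalyticRings

/-- The multiplicative form `f ↦ exp (-ord f)` (and `0 ↦ 0`) of the order function of the maximal
ideal `⟨X, Y⟩` of `K[[X, Y]]`; the order of `f ≠ 0` is the least total degree of a monomial that
occurs in `f`. -/
def orderValuation (K : Type*) [Field K] : Valuation (MvPowerSeries (Fin 2) K) ℤᵐ⁰ where
  toFun f := open Classical in if f = 0 then 0 else WithZero.exp (-(f.order.toNat : ℤ))
  map_zero' := by simp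
  map_one' := by simp [MvPowerSeries.order]
  map_mul' f g := by
    by_cases hf : f = 0
    · simp [hf]
    by_cases hg : g = 0
    · simp [hg]
    have hf' : f.order ≠ ⊤ := by simpa using hf
    have hg' : g.order ≠ ⊤ := by simpa using hg
    simp only [hf, hg, mul_eq_zero, or_self, if_false]
    rw [← WithZero.exp_add, MvPowerSeries.order_mul, ENat.toNat_add hf' hg']
    push_cast
    ring_nf
  map_add_le_max' f g := by
    by_cases hf : f = 0
    · rw [hf, zero_add]; exact le_max_right _ _
    by_cases hg : g = 0
    · rw [hg, add_zero]; exact le_max_left _ _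
    by_cases hfg : f + g = 0
    · simp [hfg]
    have hf' : f.order ≠ ⊤ := by simpa using hf
    have hg' : g.order ≠ ⊤ := by simpa using hg
    have hfg' : (f + g).order ≠ ⊤ := by simpa using hfg
    have h := MvPowerSeries.min_order_le_add (f := f) (g := g)
    simp only [hf, hg, hfg, if_false, le_max_iff, WithZero.exp_le_exp, neg_le_neg_iff,
      Nat.cast_le]
    rcases min_le_iff.1 h with h | h
    · exact Or.inl (ENat.toNat_le_toNat h hfg')
    · exact Or.inr (ENat.toNat_le_toNat h hfg')

/-- The field `E = K((X, Y)) = Quot(K[[X, Y]])`. -/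
abbrev E (K : Type*) [Field K] : Type _ := FractionRing (MvPowerSeries (Fin 2) K)

/-- The discrete valuation `v` of `E` that extends the order function. -/
def v (K : Type*) [Field K] : Valuation (E K) ℤᵐ⁰ :=
  (orderValuation K).extendToLocalization (S := nonZeroDivisors (MvPowerSeries (Fin 2) K))
    (fun f hf h => nonZeroDivisors.ne_zero hf (by
      by_contra h0
      simp [Valuation.mem_supp_iff, orderValuation, h0] at h)) (E K)

/-- The completion of the field `E` with respect to `v`. -/
abbrev Ehat (K : Type*) [Field K] : Type _ := (v K).Completion

/-- The canonical embedding of `E` into its completion. -/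
def incl (K : Type*) [Field K] : E K →+* Ehat K :=
  (UniformSpace.Completion.coeRingHom (α := WithVal (v K))).comp
    (WithVal.equiv (v K)).symm.toRingHom

section

variable {K : Type*} [Field K] {ι : Type*} (c : ι → K)

/-- The power series `X - c_i Y` in `K[[X, Y]]`. -/
def tSeries (i : ι) : MvPowerSeries (Fin 2) K :=
  MvPowerSeries.X 0 - MvPowerSeries.C (c i) * MvPowerSeries.X 1

theorem hasSubst_tSeries (i : ι) : PowerSeries.HasSubst (tSeries c i) :=
  PowerSeries.HasSubst.of_constantCoeff_zero (by simp [tSeries])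

/-- The element `t = X - c_i Y` of `E`. -/
def t (i : ι) : E K := algebraMap _ (E K) (tSeries c i)

/-- The element `z_i = Y / (X - c_i Y)` of `E`. -/
def z (i : ι) : E K := algebraMap (MvPowerSeries (Fin 2) K) (E K) (MvPowerSeries.X 1) / t c i

/-- The subring `K[z_j | j ∈ J][X, Y]` of `E`. -/
def polyRing (J : Set ι) : Subalgebra K (E K) :=
  Algebra.adjoin K (z c '' J ∪
    {algebraMap (MvPowerSeries (Fin 2) K) (E K) (MvPowerSeries.X 0),
      algebraMap (MvPowerSeries (Fin 2) K) (E K) (MvPowerSeries.X 1)})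

/-- The ring `D_J`: the completion of `K[z_j | j ∈ J][X, Y]` with respect to `v`, realized as
the closure of this ring in the completion of `E`. -/
def D (J : Set ι) : Subring (Ehat K) :=
  ((polyRing c J).toSubring.map (incl K)).topologicalClosure

/-- The ring `D_J[t⁻¹]`, where `t = X - c_j Y`. -/
def DInv (J : Set ι) (j : ι) : Subalgebra (D c J) (Ehat K) :=
  Algebra.adjoin (D c J) {(incl K (t c j))⁻¹}

/-- The ring `K[[t]] ⊆ K[[X, Y]] ⊆ E` of the power series in `t = X - c_j Y`. -/
def powerSeriesRing (j : ι) : Subring (E K) :=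
  ((algebraMap (MvPowerSeries (Fin 2) K) (E K)).comp
    (PowerSeries.substAlgHom (R := K) (hasSubst_tSeries c j)).toRingHom).range

/-- The field `K((t)) = Quot(K[[t]]) ⊆ E`, where `t = X - c_j Y`. -/
def laurentField (j : ι) : Subfield (E K) :=
  Subfield.closure (powerSeriesRing c j : Set (E K))

/-- The ring `Q_j = E · D_{I ∖ {j}}`: the subring generated by `E` and `D_{I ∖ {j}}`. -/
def Q (j : ι) : Subring (Ehat K) := (incl K).range ⊔ D c {j}ᶜ

end

end AnalyticRings

end

/-! Over `R_J = K[z_k | k ∈ J]` with `j ∈ J`, every polynomial in `X, Y` is a polynomial in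
`t = X - c_j Y`, because `Y = t z_j`, and every nonzero element of `R_J` has value `1`. Hence `D_J`
is the image of the ring of formal power series in `t` over `R_J` under evaluation, and (a) and (b)
become Weierstrass division and preparation for power series over `R_J`, carried out coefficient by
coefficient.

What makes this work is that `R_J` is generated by fractions `a(z_j) / m(z_j)` whose denominators
are units of `R_J`, since `z_k (1 + (c_j - c_k) z_j) = z_j`. So for `r ≠ 0` in `R_J` every element
of `R_J` is congruent modulo `r` to a polynomial in `z_j` of bounded degree, and a power series in
`t` whose coefficients are such polynomials lies in `K[[t]][z_j]`.

For (c), every element of `Q_j` lies in `D_{I ∖ {j}}` after multiplication by a nonzero element of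
`K[[X, Y]]`. If `I ≠ {j}`, then by (b) every element of `D_{I ∖ {j}}` is the product of an element
of `E` and a unit; otherwise `D_∅` is contained in `E`. -/

noncomputable section

namespace AnalyticRings

open scoped Polynomial PowerSeries WithZero Pointwise

section ResiduesModuloConstantCoeff

open PowerSeries

variable {R : Type*} [CommRing R]

theorem exists_coeff_mem_add_mul (M : Set R) (G : R⟦X⟧)
    (hM : ∀ s, ∃ q ∈ M, ∃ h, s = q + constantCoeff G * h) (F : R⟦X⟧) :
    ∃ P H : R⟦X⟧, (∀ n, coeff n P ∈ M) ∧ F = P + G * H := by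
  have hstep (F : R⟦X⟧) : ∃ q ∈ M, ∃ h F', F = C q + G * C h + X * F' := by
    obtain ⟨q, hq, h, hqh⟩ := hM (constantCoeff F)
    have hX : X ∣ F - (C q + G * C h) := by
      rw [X_dvd_iff, map_sub, map_add, map_mul, constantCoeff_C, constantCoeff_C, hqh, sub_self]
    obtain ⟨F', hF'⟩ := hX
    exact ⟨q, hq, h, F', by rw [← hF', add_sub_cancel]⟩
  choose q hq h next hnext using hstep
  let Fs (n : ℕ) : R⟦X⟧ := next^[n] F
  have hFs (n : ℕ) : Fs n = C (q (Fs n)) + G * C (h (Fs n)) + X * Fs (n + 1) := by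
    have : Fs (n + 1) = next (Fs n) := Function.iterate_succ_apply' next n F
    rw [this, ← hnext]
  let Ps (n : ℕ) : R⟦X⟧ := PowerSeries.mk fun i => q (Fs (n + i))
  let Hs (n : ℕ) : R⟦X⟧ := PowerSeries.mk fun i => h (Fs (n + i))
  have mk_shift (a : ℕ → R) (n : ℕ) : (PowerSeries.mk fun i => a (n + i)) =
      C (a n) + X * PowerSeries.mk fun i => a (n + 1 + i) := by
    ext (_ | i)
    · simp
    · simp [coeff_succ_X_mul, add_comm, add_left_comm]
  have hdvd (k : ℕ) : ∀ n, X ^ k ∣ Fs n - (Ps n + G * Hs n) := by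
    induction k with
    | zero => simp
    | succ k ih =>
      intro n
      have hrec : Fs n - (Ps n + G * Hs n) =
          X * (Fs (n + 1) - (Ps (n + 1) + G * Hs (n + 1))) := by
        simp only [Ps, Hs]
        rw [mk_shift (fun i => q (Fs i)), mk_shift (fun i => h (Fs i))]
        linear_combination hFs n
      rw [hrec, pow_succ']
      exact mul_dvd_mul_left X (ih (n + 1))
  refine ⟨Ps 0, Hs 0, fun n => by simpa [Ps] using hq _, ?_⟩
  refine sub_eq_zero.1 (PowerSeries.ext fun n => ?_)
  exact X_pow_dvd_iff.1 (hdvd (n + 1) 0) n n.lt_succ_self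

theorem exists_unit_coeff_mul_mem (M : AddSubgroup R) (G : R⟦X⟧) {p : R} (hp : p ∈ M)
    (hGp : Associated (constantCoeff G) p)
    (hM : ∀ s, ∃ q ∈ M, ∃ h, s = q + constantCoeff G * h) :
    ∃ U : R⟦X⟧ˣ, ∀ n, coeff n (G * (U : R⟦X⟧)) ∈ M := by
  obtain ⟨w, hw⟩ := hGp
  obtain ⟨G', hG'⟩ : X ∣ C p - G * C (w : R) := by
    rw [X_dvd_iff, map_sub, map_mul, constantCoeff_C, constantCoeff_C, hw, sub_self]
  obtain ⟨P, H, hP, hPH⟩ := exists_coeff_mem_add_mul M G hM G'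
  have hU : IsUnit (C (w : R) + X * H) := by
    rw [isUnit_iff_constantCoeff]
    simp
  refine ⟨hU.unit, fun n => ?_⟩
  have hGU : G * (hU.unit : R⟦X⟧) = C p - X * P := by
    rw [IsUnit.unit_spec]
    linear_combination -hG' - X * hPH
  rw [hGU]
  cases n with
  | zero => simpa using hp
  | succ n => simpa [coeff_succ_X_mul, coeff_C] using hP n

end ResiduesModuloConstantCoeff

section PolynomialValues

open Polynomial

variable {K R : Type*} [Field K] [CommRing R] [Algebra K R] (φ : K[X] →ₐ[K] R)

theorem exists_isUnit_mul_eq_of_adjoin_eq_top {s : Set R} (hs : Algebra.adjoin K s = ⊤)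
    (hφ : ∀ r ∈ s, ∃ m a, IsUnit (φ m) ∧ r * φ m = φ a) (r : R) :
    ∃ m a, IsUnit (φ m) ∧ r * φ m = φ a := by
  have hr : r ∈ Algebra.adjoin K s := hs ▸ Algebra.mem_top
  induction hr using Algebra.adjoin_induction with
  | mem r hr => exact hφ r hr
  | algebraMap x => exact ⟨1, C x, by simp, by simpa using (φ.commutes x).symm⟩
  | add r r' _ _ hr hr' =>
    obtain ⟨m, a, hm, hma⟩ := hr
    obtain ⟨m', a', hm', hma'⟩ := hr'
    refine ⟨m * m', a * m' + m * a', by simpa using hm.mul hm', ?_⟩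
    simp only [map_add, map_mul]
    linear_combination φ m' * hma + φ m * hma'
  | mul r r' _ _ hr hr' =>
    obtain ⟨m, a, hm, hma⟩ := hr
    obtain ⟨m', a', hm', hma'⟩ := hr'
    refine ⟨m * m', a * a', by simpa using hm.mul hm', ?_⟩
    rw [map_mul, map_mul, mul_mul_mul_comm, hma, hma']

/-- The additive group `{φ(q) | deg q < n}` of remainders; with `φ` the evaluation at `z_j`, these
are the polynomials of degree `< n` in `z_j`. -/
def valuesDegreeLT (n : ℕ) : AddSubgroup R :=
  ((degreeLT K n).map φ.toLinearMap).toAddSubgroup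

variable {φ} in
theorem mem_valuesDegreeLT {n : ℕ} {r : R} :
    r ∈ valuesDegreeLT φ n ↔ ∃ q ∈ degreeLT K n, φ q = r := Iff.rfl

theorem exists_associated_forall_eq_add_mul
    (hφ : ∀ r, ∃ m a, IsUnit (φ m) ∧ r * φ m = φ a) {r : R} (hr : r ≠ 0) :
    ∃ n, (∃ p ∈ valuesDegreeLT φ n, Associated r p) ∧
      ∀ s, ∃ q ∈ valuesDegreeLT φ n, ∃ h, s = q + r * h := by
  -- Among the polynomials whose value is associated to `r`, one of minimal degree is coprime to
  -- every polynomial whose value is a unit.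
  obtain ⟨P, hrP, hmin⟩ : ∃ P, Associated r (φ P) ∧
      ∀ P', Associated r (φ P') → P.natDegree ≤ P'.natDegree := by
    obtain ⟨m, a, hm, hma⟩ := hφ r
    have hne : {P | Associated r (φ P)}.Nonempty := ⟨a, hm.unit, hma⟩
    exact ⟨_, Function.argminOn_mem natDegree _ hne,
      fun P' hP' => Function.argminOn_le natDegree _ hP'⟩
  have hP0 : P ≠ 0 := by
    rintro rfl
    exact hr (by simpa using hrP)
  have hcoprime {m : K[X]} (hm : IsUnit (φ m)) : IsCoprime P m := by
    refine IsRelPrime.isCoprime fun d hdP hdm => ?_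
    obtain ⟨P', rfl⟩ := hdP
    have hd : IsUnit (φ d) := isUnit_of_dvd_unit (map_dvd φ hdm) hm
    have hle := hmin P' (hrP.trans (by simpa using associated_unit_mul_left (φ P') (φ d) hd))
    rw [natDegree_mul (left_ne_zero_of_mul hP0) (right_ne_zero_of_mul hP0)] at hle
    rw [isUnit_iff_degree_eq_zero, degree_eq_natDegree (left_ne_zero_of_mul hP0)]
    exact_mod_cast (by lia : d.natDegree = 0)
  have hPlt : P ∈ degreeLT K (P.natDegree + 1) :=
    mem_degreeLT.2 (degree_le_natDegree.trans_lt (by exact_mod_cast P.natDegree.lt_succ_self))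
  refine ⟨P.natDegree + 1, ⟨φ P, ⟨P, hPlt, rfl⟩, hrP⟩, fun s => ?_⟩
  obtain ⟨w, hw⟩ := hrP
  obtain ⟨m, a, hm, hma⟩ := hφ s
  obtain ⟨α, β, hαβ⟩ := hcoprime hm
  have hbezout : φ α * φ P + φ β * φ m = 1 := by simpa using congrArg φ hαβ
  have hdiv : φ P * φ (β * a / P) + φ (β * a % P) = φ β * φ a := by
    simpa using congrArg φ (EuclideanDomain.div_add_mod (β * a) P)
  refine ⟨φ (β * a % P), ⟨_, mem_degreeLT.2 ?_, rfl⟩, w * (φ (β * a / P) + φ α * s), ?_⟩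
  · exact (EuclideanDomain.mod_lt _ hP0).trans (mem_degreeLT.1 hPlt)
  · linear_combination -s * hbezout + φ β * hma - hdiv - (φ (β * a / P) + φ α * s) * hw

theorem exists_eq_sum_map_mul_C_pow {n : ℕ} {F : R⟦X⟧}
    (hF : ∀ k, PowerSeries.coeff k F ∈ valuesDegreeLT φ n) :
    ∃ p : ℕ → K⟦X⟧, F = ∑ l ∈ Finset.range n,
      PowerSeries.map (algebraMap K R) (p l) * PowerSeries.C (φ X) ^ l := by
  choose q hq hqF using fun k => mem_valuesDegreeLT.1 (hF k)
  refine ⟨fun l => PowerSeries.mk fun k => (q k).coeff l, PowerSeries.ext fun k => ?_⟩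
  have hqk : q k = ∑ l ∈ Finset.range n, C ((q k).coeff l) * X ^ l := by
    rw [← Fin.sum_univ_eq_sum_range fun l => C ((q k).coeff l) * X ^ l,
      sum_fin (fun l a => C a * X ^ l) (by simp) (mem_degreeLT.1 (hq k)), sum_C_mul_X_pow_eq]
  have hφq : φ (q k) = ∑ l ∈ Finset.range n, algebraMap K R ((q k).coeff l) * φ X ^ l := by
    conv_lhs => rw [hqk]
    simp only [map_sum, map_mul, map_pow, ← Polynomial.algebraMap_eq, AlgHom.commutes]
  simp only [map_sum, ← map_pow, PowerSeries.coeff_mul_C, PowerSeries.coeff_map,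
    PowerSeries.coeff_mk, ← hqF, hφq]

end PolynomialValues

section ValuedField

open WithZero Topology

theorem exists_exp_neg_lt {γ : ℤᵐ⁰} (hγ : γ ≠ 0) : ∃ n : ℕ, exp (-(n : ℤ)) < γ := by
  refine ⟨(1 - log γ).toNat, ?_⟩
  rw [← exp_log hγ, exp_lt_exp, log_exp]
  lia

variable {L : Type*} [Field L] [Valued L ℤᵐ⁰]

theorem eq_zero_of_forall_le_exp {x : L} (h : ∀ n : ℕ, Valued.v x ≤ exp (-(n : ℤ))) : x = 0 := by
  by_contra hx
  obtain ⟨n, hn⟩ := exists_exp_neg_lt ((Valuation.ne_zero_iff Valued.v).2 hx)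
  exact (h n).not_gt hn

variable {π : L} (hπ : Valued.v π = exp (-1))

include hπ

theorem valued_pow (n : ℕ) : Valued.v (π ^ n) = exp (-(n : ℤ)) := by
  rw [map_pow, hπ, ← exp_nsmul]
  simp

theorem hasBasis_nhds_zero_le_exp :
    (𝓝 (0 : L)).HasBasis (fun _ : ℕ => True) fun n => {x | Valued.v x ≤ exp (-(n : ℤ))} := by
  refine (Valued.hasBasis_nhds_zero L ℤᵐ⁰).to_hasBasis (fun γ _ => ?_) fun n _ => ?_
  · have h0 : MonoidWithZeroHom.ValueGroup₀.embedding γ.1 ≠ 0 := by simp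
    obtain ⟨n, hn⟩ := exists_exp_neg_lt h0
    refine ⟨n, trivial, fun x hx => ?_⟩
    exact (Valuation.restrict_lt_iff_lt_embedding _).2 (lt_of_le_of_lt hx hn)
  · have h0 : (Valued.v : Valuation L ℤᵐ⁰).restrict (π ^ n) ≠ 0 := by
      rw [Valuation.ne_zero_iff, ← Valuation.ne_zero_iff Valued.v, valued_pow hπ]
      exact exp_ne_zero
    refine ⟨Units.mk0 _ h0, trivial, fun x hx => ?_⟩
    rw [Set.mem_ofPred_eq, ← valued_pow hπ]
    exact ((Valuation.restrict_lt_iff _).1 hx).le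

theorem mem_closure_iff_le_exp {S : Set L} {x : L} :
    x ∈ closure S ↔ ∀ n : ℕ, ∃ y ∈ S, Valued.v (x - y) ≤ exp (-(n : ℤ)) := by
  have hx := (hasBasis_nhds_zero_le_exp hπ).comap (· - x)
  rw [nhds_translation_sub] at hx
  simpa [Valuation.map_sub_swap] using mem_closure_iff_nhds_basis hx

theorem isLinearTopology_integer :
    IsLinearTopology (Valued.v (R := L)).integer (Valued.v (R := L)).integer := by
  refine .mk_of_hasBasis _ (p := fun _ : ℕ => True)
    (s := fun n => Valued.v.leIdeal (exp (-(n : ℤ)))) ?_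
  rw [nhds_subtype]
  exact (hasBasis_nhds_zero_le_exp hπ).comap _

theorem exists_ringHom_powerSeries [CompleteSpace L] {R : Type*} [CommRing R] (φ : R →+* L)
    (hφ : ∀ r, Valued.v (φ r) ≤ 1) :
    ∃ Ψ : R⟦X⟧ →+* L, (∀ r, Ψ (PowerSeries.C r) = φ r) ∧ Ψ PowerSeries.X = π ∧
      ∀ F, Valued.v (Ψ F) ≤ 1 := by
  let O : Subring L := (Valued.v (R := L)).integer
  have : IsLinearTopology O O := isLinearTopology_integer hπ
  have : IsUniformAddGroup O := inferInstanceAs (IsUniformAddGroup O.toAddSubgroup)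
  have : CompleteSpace O := (Valued.isClosed_integer L).completeSpace_coe
  let _ : UniformSpace R := ⊥
  have : DiscreteTopology R := ⟨rfl⟩
  let ψ : R →+* O := φ.codRestrict O hφ
  have hπ1 : Valued.v π ≤ 1 := by
    rw [hπ, ← exp_zero, exp_le_exp]
    lia
  let ϖ : O := ⟨π, hπ1⟩
  have hϖ : PowerSeries.HasEval ϖ := by
    refine tendsto_subtype_rng.2 (((hasBasis_nhds_zero_le_exp hπ).tendsto_right_iff).2 ?_)
    refine fun n _ => Filter.eventually_atTop.2 ⟨n, fun k hk => ?_⟩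
    rw [Set.mem_ofPred_eq, SubmonoidClass.coe_pow, valued_pow hπ, exp_le_exp]
    lia
  refine ⟨O.subtype.comp (PowerSeries.eval₂Hom (φ := ψ) continuous_of_discreteTopology hϖ), ?_⟩
  refine ⟨fun r => ?_, ?_, fun F => (PowerSeries.eval₂Hom _ hϖ F).2⟩
  · rw [RingHom.comp_apply, PowerSeries.coe_eval₂Hom, PowerSeries.eval₂_C]
    rfl
  · simp [PowerSeries.coe_eval₂Hom, ϖ]

omit hπ

theorem valued_sub_trunc_le {R : Type*} [CommRing R] {Ψ : R⟦X⟧ →+* L}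
    (hX : Valued.v (Ψ PowerSeries.X) = exp (-1)) (hΨ : ∀ F, Valued.v (Ψ F) ≤ 1) (F : R⟦X⟧)
    (n : ℕ) : Valued.v (Ψ F - Ψ (PowerSeries.trunc n F : R[X])) ≤ exp (-(n : ℤ)) := by
  have h := congrArg Ψ (PowerSeries.eq_X_pow_mul_shift_add_trunc n F)
  rw [map_add, map_mul, map_pow, ← sub_eq_iff_eq_add] at h
  rw [h, map_mul, valued_pow hX]
  exact mul_le_of_le_one_right' (hΨ _)

theorem powerSeries_ringHom_ext {R : Type*} [CommRing R] {Ψ Ψ' : R⟦X⟧ →+* L}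
    (hC : ∀ r, Ψ (PowerSeries.C r) = Ψ' (PowerSeries.C r))
    (hX : Ψ PowerSeries.X = Ψ' PowerSeries.X) (hv : Valued.v (Ψ PowerSeries.X) = exp (-1))
    (hΨ : ∀ F, Valued.v (Ψ F) ≤ 1) (hΨ' : ∀ F, Valued.v (Ψ' F) ≤ 1) : Ψ = Ψ' := by
  have hpoly : Ψ.comp Polynomial.coeToPowerSeries.ringHom =
      Ψ'.comp Polynomial.coeToPowerSeries.ringHom :=
    Polynomial.ringHom_ext (by simpa using hC) (by simpa using hX)
  refine RingHom.ext fun F => sub_eq_zero.1 (eq_zero_of_forall_le_exp fun n => ?_)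
  have htrunc : Ψ (PowerSeries.trunc n F : R[X]) = Ψ' (PowerSeries.trunc n F : R[X]) :=
    RingHom.congr_fun hpoly (PowerSeries.trunc n F)
  rw [← sub_sub_sub_cancel_right _ _ (Ψ (PowerSeries.trunc n F : R[X]))]
  refine Valuation.map_sub_le _ (valued_sub_trunc_le hv hΨ F n) ?_
  rw [htrunc]
  exact valued_sub_trunc_le (hX ▸ hv) hΨ' F n

theorem powerSeries_mem_topologicalClosure {R : Type*} [CommRing R] {Ψ : R⟦X⟧ →+* L}
    (hX : Valued.v (Ψ PowerSeries.X) = exp (-1)) (hΨ : ∀ F, Valued.v (Ψ F) ≤ 1) {S : Subring L}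
    (hCS : ∀ r, Ψ (PowerSeries.C r) ∈ S) (hXS : Ψ PowerSeries.X ∈ S) (F : R⟦X⟧) :
    Ψ F ∈ S.topologicalClosure := by
  have hpoly (P : R[X]) : Ψ (P : R⟦X⟧) ∈ S := by
    induction P using Polynomial.induction_on' with
    | add P Q hP hQ =>
      rw [Polynomial.coe_add, map_add]
      exact add_mem hP hQ
    | monomial k a =>
      rw [Polynomial.coe_monomial, PowerSeries.monomial_eq_C_mul_X_pow, map_mul, map_pow]
      exact mul_mem (hCS a) (pow_mem hXS k)
  exact (mem_closure_iff_le_exp hX).2 fun n => ⟨_, hpoly _, valued_sub_trunc_le hX hΨ F n⟩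

theorem valued_powerSeries_le_exp_iff {R : Type*} [CommRing R] {Ψ : R⟦X⟧ →+* L}
    (hX : Valued.v (Ψ PowerSeries.X) = exp (-1))
    (hC : ∀ r : R, r ≠ 0 → Valued.v (Ψ (PowerSeries.C r)) = 1)
    (hΨ : ∀ F, Valued.v (Ψ F) ≤ 1) (F : R⟦X⟧) (n : ℕ) :
    Valued.v (Ψ F) ≤ exp (-(n : ℤ)) ↔ n ≤ F.order := by
  have hunit {G : R⟦X⟧} (hG : PowerSeries.constantCoeff G ≠ 0) : Valued.v (Ψ G) = 1 := by
    obtain ⟨G', hG'⟩ : ∃ G', G = G' * PowerSeries.X + PowerSeries.C (PowerSeries.constantCoeff G) :=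
      ⟨_, PowerSeries.eq_shift_mul_X_add_const G⟩
    rw [hG', map_add, ← hC _ hG]
    refine Valuation.map_add_eq_of_lt_right _ ?_
    rw [hC _ hG, map_mul, map_mul, hX]
    calc Valued.v (Ψ G') * exp (-1) ≤ exp (-1 : ℤ) := mul_le_of_le_one_left' (hΨ G')
      _ < exp 0 := exp_lt_exp.2 (by lia)
      _ = 1 := exp_zero
  obtain rfl | hF := eq_or_ne F 0
  · simp
  obtain ⟨m, hm⟩ := ENat.ne_top_iff_exists.1 (PowerSeries.order_eq_top.not.2 hF)
  have hvF : Valued.v (Ψ F) = exp (-(m : ℤ)) := by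
    rw [← PowerSeries.X_pow_order_mul_divXPowOrder (f := F), map_mul, map_mul,
      hunit (PowerSeries.constantCoeff_divXPowOrder_eq_zero_iff.not.2 hF), mul_one, map_pow,
      valued_pow hX, ← hm, ENat.toNat_natCast]
  rw [hvF, exp_le_exp, ← hm]
  simp

theorem isClosed_range_of_le_exp_iff {σ A : Type*} [CommRing A] {Ψ : MvPowerSeries σ A →+ L}
    (hπ : Valued.v π = exp (-1))
    (hΨ : ∀ F (n : ℕ), Valued.v (Ψ F) ≤ exp (-(n : ℤ)) ↔ (n : ℕ∞) ≤ F.order) :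
    IsClosed (Set.range Ψ) := by
  refine isClosed_of_closure_subset fun x hx => ?_
  simp only [mem_closure_iff_le_exp hπ, Set.exists_range_iff] at hx
  choose F hF using hx
  have hcoeff {d : σ →₀ ℕ} {m n : ℕ} (hm : d.degree < m) (hmn : m ≤ n) :
      MvPowerSeries.coeff d (F n) = MvPowerSeries.coeff d (F m) := by
    have hle : (m : ℕ∞) ≤ (F n - F m).order := by
      rw [← hΨ, map_sub, ← sub_sub_sub_cancel_left _ _ x]
      exact Valuation.map_sub_le _ (hF m) ((hF n).trans (exp_le_exp.2 (by lia)))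
    rw [← sub_eq_zero, ← map_sub]
    exact MvPowerSeries.coeff_of_lt_order (hle.trans_lt' (by exact_mod_cast hm))
  let G : MvPowerSeries σ A := fun d => MvPowerSeries.coeff d (F (d.degree + 1))
  have hG (n : ℕ) : (n : ℕ∞) ≤ (F n - G).order := MvPowerSeries.nat_le_order fun d hd => by
    rw [map_sub, hcoeff (Nat.lt_succ_self _) hd]
    exact sub_self _
  refine ⟨G, (sub_eq_zero.1 (eq_zero_of_forall_le_exp fun n => ?_)).symm⟩
  rw [← sub_add_sub_cancel x (Ψ (F n)), ← map_sub]
  exact Valuation.map_add_le _ (hF n) ((hΨ _ n).2 (hG n))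

end ValuedField

section ValuationOfE

variable {K : Type*} [Field K]

theorem order_coe_of_isHomogeneous {σ A : Type*} [CommSemiring A] {H : MvPolynomial σ A} {n : ℕ}
    (hH : H.IsHomogeneous n) (h0 : H ≠ 0) : (H : MvPowerSeries σ A).order = n := by
  rw [MvPowerSeries.order_eq_nat]
  obtain ⟨d, hd⟩ := MvPolynomial.ne_zero_iff.1 h0
  refine ⟨⟨d, by simpa using hd, ?_⟩, fun d hd => ?_⟩
  · exact of_not_not fun h => hd (hH.coeff_eq_zero h)
  · simpa using hH.coeff_eq_zero hd.ne

theorem valued_incl (e : E K) : Valued.v (incl K e) = v K e :=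
  Valued.valuedCompletion_apply (K := WithVal (v K)) _

theorem v_algebraMap_eq_exp {f : MvPowerSeries (Fin 2) K} {n : ℕ} (h : f.order = n) :
    v K (algebraMap _ (E K) f) = WithZero.exp (-(n : ℤ)) := by
  have hf : f ≠ 0 := by
    rintro rfl
    simp at h
  have hv : v K (algebraMap _ (E K) f) = orderValuation K f :=
    Valuation.extendToLocalization_apply_map_apply _ _ _ _
  simp [hv, orderValuation, hf, h]

theorem v_algebraMap_le_exp_iff (f : MvPowerSeries (Fin 2) K) (n : ℕ) :
    v K (algebraMap _ (E K) f) ≤ WithZero.exp (-(n : ℤ)) ↔ (n : ℕ∞) ≤ f.order := by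
  obtain rfl | hf := eq_or_ne f 0
  · simp
  · obtain ⟨m, hm⟩ := ENat.ne_top_iff_exists.1 (MvPowerSeries.order_eq_top_iff.not.2 hf)
    rw [v_algebraMap_eq_exp hm.symm, WithZero.exp_le_exp, ← hm]
    simp

theorem v_algebraMap_le_one (f : MvPowerSeries (Fin 2) K) : v K (algebraMap _ (E K) f) ≤ 1 := by
  simpa using (v_algebraMap_le_exp_iff f 0).2 (by simp)

theorem algebraMap_C (a : K) :
    algebraMap (MvPowerSeries (Fin 2) K) (E K) (MvPowerSeries.C a) = algebraMap K (E K) a :=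
  (IsScalarTower.algebraMap_apply K (MvPowerSeries (Fin 2) K) (E K) a).symm

theorem valued_incl_algebraMap_X (i : Fin 2) :
    Valued.v (incl K (algebraMap _ (E K) (MvPowerSeries.X i : MvPowerSeries (Fin 2) K))) =
      WithZero.exp (-1) := by
  rw [valued_incl, v_algebraMap_eq_exp (n := 1), Nat.cast_one]
  simpa using order_coe_of_isHomogeneous (MvPolynomial.isHomogeneous_X K i)
    (MvPolynomial.X_ne_zero i)

variable {ι : Type*} (c : ι → K)

theorem tSeries_eq_coe (i : ι) : tSeries c i =
    ((MvPolynomial.X 0 - MvPolynomial.C (c i) * MvPolynomial.X 1 : MvPolynomial (Fin 2) K) :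
      MvPowerSeries (Fin 2) K) := by
  rw [← MvPolynomial.coeToMvPowerSeries.ringHom_apply, map_sub, map_mul]
  simp [tSeries]

theorem isHomogeneous_X_sub_C_mul_X (a : K) :
    (MvPolynomial.X 0 - MvPolynomial.C a * MvPolynomial.X 1 :
      MvPolynomial (Fin 2) K).IsHomogeneous 1 :=
  (MvPolynomial.isHomogeneous_X _ _).sub ((MvPolynomial.isHomogeneous_X _ _).C_mul _)

theorem v_t (i : ι) : v K (t c i) = WithZero.exp (-1) := by
  rw [t, tSeries_eq_coe]
  refine v_algebraMap_eq_exp (order_coe_of_isHomogeneous (isHomogeneous_X_sub_C_mul_X _) ?_)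
  intro h
  simpa using congrArg (MvPolynomial.aeval ![(1 : K), 0]) h

theorem t_ne_zero (i : ι) : t c i ≠ 0 := by
  rw [← Valuation.ne_zero_iff (v K), v_t]
  exact WithZero.exp_ne_zero

theorem incl_t_ne_zero (i : ι) : incl K (t c i) ≠ 0 :=
  (map_ne_zero _).2 (t_ne_zero c i)

theorem valued_incl_t (i : ι) : Valued.v (incl K (t c i)) = WithZero.exp (-1) := by
  rw [valued_incl, v_t]

theorem algebraMap_X_one (i : ι) :
    algebraMap (MvPowerSeries (Fin 2) K) (E K) (MvPowerSeries.X 1) = t c i * z c i :=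
  (mul_div_cancel₀ _ (t_ne_zero c i)).symm

theorem t_eq (i : ι) : t c i =
    algebraMap (MvPowerSeries (Fin 2) K) (E K) (MvPowerSeries.X 0) -
      algebraMap K (E K) (c i) *
        algebraMap (MvPowerSeries (Fin 2) K) (E K) (MvPowerSeries.X 1) := by
  rw [t, tSeries, map_sub, map_mul, algebraMap_C]

theorem algebraMap_X_zero (i : ι) :
    algebraMap (MvPowerSeries (Fin 2) K) (E K) (MvPowerSeries.X 0) =
      t c i * (1 + algebraMap K (E K) (c i) * z c i) := by
  linear_combination -t_eq c i + algebraMap K (E K) (c i) * algebraMap_X_one c i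

theorem z_mul_one_add (j k : ι) :
    z c k * (1 + algebraMap K (E K) (c j - c k) * z c j) = z c j := by
  refine mul_left_cancel₀ (t_ne_zero c j) ?_
  rw [map_sub]
  linear_combination z c k * (t_eq c j - t_eq c k) - algebraMap_X_one c k +
    (1 - z c k * (algebraMap K (E K) (c j) - algebraMap K (E K) (c k))) * algebraMap_X_one c j

theorem one_add_mul_one_add (j k : ι) :
    (1 + algebraMap K (E K) (c j - c k) * z c j) *
      (1 + algebraMap K (E K) (c k - c j) * z c k) = 1 := by
  rw [← neg_sub (c j) (c k), map_neg]
  linear_combination (-algebraMap K (E K) (c j - c k)) * z_mul_one_add c j k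

theorem algebraMap_coe_eq_aeval (p : MvPolynomial (Fin 2) K) :
    algebraMap (MvPowerSeries (Fin 2) K) (E K) p =
      MvPolynomial.aeval
        (fun i => algebraMap (MvPowerSeries (Fin 2) K) (E K) (MvPowerSeries.X i)) p := by
  induction p using MvPolynomial.induction_on with
  | C a => simp [algebraMap_C]
  | add p q hp hq => simp [hp, hq]
  | mul_X p i hp => simp [hp]

theorem aeval_homogenize {A B : Type*} [CommSemiring A] [CommSemiring B] [Algebra A B] {P : A[X]}
    {n : ℕ} (hn : P.natDegree ≤ n) (x y : B) :
    MvPolynomial.aeval ![y * x, y] (P.homogenize n) = y ^ n * Polynomial.aeval x P := by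
  refine Polynomial.induction_with_natDegree_le (fun P =>
    MvPolynomial.aeval ![y * x, y] (P.homogenize n) = y ^ n * Polynomial.aeval x P) n ?_ ?_ ?_ P hn
  · simp
  · intro m a _ hm
    obtain ⟨k, rfl⟩ := Nat.exists_eq_add_of_le hm
    simp
    ring
  · intro P Q _ _ hP hQ
    simp [hP, hQ, mul_add]

theorem aeval_homogenize_ne_zero {A : Type*} [CommRing A] (a : A) {P : A[X]} (hP : P ≠ 0) :
    MvPolynomial.aeval ![MvPolynomial.X 1, MvPolynomial.X 0 - MvPolynomial.C a * MvPolynomial.X 1]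
      (P.homogenize P.natDegree) ≠ (0 : MvPolynomial (Fin 2) A) := by
  intro h
  refine hP ?_
  rw [← P.aeval_homogenize_X_one le_rfl]
  convert congrArg (MvPolynomial.aeval
    ![1 + Polynomial.C a * Polynomial.X, (Polynomial.X : Polynomial A)]) h using 1
  · rw [← AlgHom.comp_apply, MvPolynomial.comp_aeval]
    congr 2
    ext i
    fin_cases i <;> simp
  · simp

theorem v_aeval_z (j : ι) {P : K[X]} (hP : P ≠ 0) : v K (Polynomial.aeval (z c j) P) = 1 := by
  set n := P.natDegree
  let H : MvPolynomial (Fin 2) K := MvPolynomial.aeval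
    ![MvPolynomial.X 1, MvPolynomial.X 0 - MvPolynomial.C (c j) * MvPolynomial.X 1]
    (P.homogenize n)
  have hHhom : H.IsHomogeneous n := by
    rw [← one_mul n]
    refine (P.isHomogeneous_homogenize).aeval _ (Fin.forall_fin_two.2 ⟨?_, ?_⟩)
    · exact MvPolynomial.isHomogeneous_X _ _
    · exact isHomogeneous_X_sub_C_mul_X _
  have hH0 : H ≠ 0 := aeval_homogenize_ne_zero (c j) hP
  have hval : t c j ^ n * Polynomial.aeval (z c j) P =
      algebraMap (MvPowerSeries (Fin 2) K) (E K) H := by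
    rw [← aeval_homogenize le_rfl, algebraMap_coe_eq_aeval, ← AlgHom.comp_apply,
      MvPolynomial.comp_aeval, ← algebraMap_X_one, t_eq]
    congr 2
    ext i
    fin_cases i <;> simp
  have hv := congrArg (v K) hval
  rw [map_mul, map_pow, v_t, v_algebraMap_eq_exp (order_coe_of_isHomogeneous hHhom hH0),
    ← WithZero.exp_nsmul, smul_neg, nsmul_one] at hv
  exact mul_left_cancel₀ WithZero.exp_ne_zero (hv.trans (mul_one _).symm)

end ValuationOfE

section PowerSeriesOverZRing

open Polynomial

variable {K : Type*} [Field K] {ι : Type*} (c : ι → K) {J : Set ι} {j : ι} (hj : j ∈ J)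

/-- The ring `R_J = K[z_k | k ∈ J]`, over which the elements of `D_J` are power series in `t`. -/
def zRing (J : Set ι) : Subalgebra K (E K) := Algebra.adjoin K (z c '' J)

theorem z_mem_zRing {k : ι} (hk : k ∈ J) : z c k ∈ zRing c J :=
  Algebra.subset_adjoin ⟨k, hk, rfl⟩

/-- Evaluation at `z_j` of polynomials over `K`, with values in `R_J`. -/
def evalZ : K[X] →ₐ[K] zRing c J := aeval ⟨z c j, z_mem_zRing c hj⟩

theorem coe_evalZ (P : K[X]) : (evalZ c hj P : E K) = aeval (z c j) P :=
  (aeval_algHom_apply (zRing c J).val _ P).symm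

theorem exists_isUnit_mul_evalZ_eq (r : zRing c J) :
    ∃ m a, IsUnit (evalZ c hj m) ∧ r * evalZ c hj m = evalZ c hj a := by
  refine exists_isUnit_mul_eq_of_adjoin_eq_top _ Algebra.adjoin_adjoin_coe_preimage ?_ r
  rintro ⟨_, hr⟩ ⟨k, _, rfl⟩
  have hm : (evalZ c hj (1 + C (c j - c k) * X) : E K) =
      1 + algebraMap K (E K) (c j - c k) * z c j := by
    rw [coe_evalZ, map_add, map_mul, map_one, aeval_C, aeval_X]
  let w : zRing c J := 1 + algebraMap K (zRing c J) (c k - c j) * ⟨z c k, hr⟩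
  refine ⟨1 + C (c j - c k) * X, X, .of_mul_eq_one w (Subtype.ext ?_), Subtype.ext ?_⟩
  · exact (congrArg (· * (w : E K)) hm).trans (one_add_mul_one_add c j k)
  · rw [coe_evalZ, aeval_X]
    exact (congrArg (z c k * ·) hm).trans (z_mul_one_add c j k)

include hj in
theorem v_eq_one_of_mem_zRing {r : zRing c J} (hr : r ≠ 0) : v K (r : E K) = 1 := by
  obtain ⟨m, a, hm, hma⟩ := exists_isUnit_mul_evalZ_eq c hj r
  have hv {P : K[X]} (hP : evalZ c hj P ≠ 0) : v K (evalZ c hj P : E K) = 1 := by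
    rw [coe_evalZ]
    exact v_aeval_z c j fun h => hP (by rw [h, map_zero])
  have hra : evalZ c hj a ≠ 0 := hma ▸ mul_ne_zero hr hm.ne_zero
  simpa [hv hm.ne_zero, hv hra] using congrArg (fun s : zRing c J => v K (s : E K)) hma

include hj in
theorem v_le_one_of_mem_zRing (r : zRing c J) : v K (r : E K) ≤ 1 := by
  obtain rfl | hr := eq_or_ne r 0
  · simp
  · exact (v_eq_one_of_mem_zRing c hj hr).le

/-- Evaluation at `t = X - c_j Y` of formal power series over `R_J`, with values in `Ê`. Its
existence comes from `exists_ringHom_powerSeries`, and continuity determines it. -/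
def seriesHom : (zRing c J)⟦X⟧ →+* Ehat K :=
  (exists_ringHom_powerSeries (valued_incl_t c j) ((incl K).comp (zRing c J).val.toRingHom)
    fun r => (valued_incl _).trans_le (v_le_one_of_mem_zRing c hj r)).choose

theorem seriesHom_spec : (∀ r, seriesHom c hj (PowerSeries.C r) = incl K r) ∧
    seriesHom c hj PowerSeries.X = incl K (t c j) ∧ ∀ F, Valued.v (seriesHom c hj F) ≤ 1 :=
  (exists_ringHom_powerSeries (valued_incl_t c j) ((incl K).comp (zRing c J).val.toRingHom)
    fun r => (valued_incl _).trans_le (v_le_one_of_mem_zRing c hj r)).choose_spec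

theorem seriesHom_C (r : zRing c J) : seriesHom c hj (PowerSeries.C r) = incl K r :=
  (seriesHom_spec c hj).1 r

theorem seriesHom_X : seriesHom c hj PowerSeries.X = incl K (t c j) := (seriesHom_spec c hj).2.1

theorem valued_seriesHom_le_one (F : (zRing c J)⟦X⟧) : Valued.v (seriesHom c hj F) ≤ 1 :=
  (seriesHom_spec c hj).2.2 F

theorem valued_seriesHom_X : Valued.v (seriesHom c hj PowerSeries.X) = WithZero.exp (-1) := by
  rw [seriesHom_X, valued_incl_t]

theorem isClosed_range_seriesHom : IsClosed (Set.range (seriesHom c hj)) := by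
  have hC (r : zRing c J) (hr : r ≠ 0) : Valued.v (seriesHom c hj (PowerSeries.C r)) = 1 := by
    rw [seriesHom_C, valued_incl, v_eq_one_of_mem_zRing c hj hr]
  refine isClosed_range_of_le_exp_iff (Ψ := (seriesHom c hj).toAddMonoidHom)
    (valued_incl_t c j) fun F n => ?_
  rw [← PowerSeries.order_eq_order]
  exact valued_powerSeries_le_exp_iff (valued_seriesHom_X c hj) hC
    (valued_seriesHom_le_one c hj) F n

theorem algebraMap_X_mem_polyRing (J : Set ι) (i : Fin 2) :
    algebraMap (MvPowerSeries (Fin 2) K) (E K) (MvPowerSeries.X i) ∈ polyRing c J := by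
  refine Algebra.subset_adjoin ?_
  fin_cases i <;> simp

theorem t_mem_polyRing (J : Set ι) (i : ι) : t c i ∈ polyRing c J := by
  rw [t_eq]
  exact sub_mem (algebraMap_X_mem_polyRing c J 0)
    (mul_mem (Subalgebra.algebraMap_mem _ _) (algebraMap_X_mem_polyRing c J 1))

theorem incl_mem_D {y : E K} (hy : y ∈ polyRing c J) : incl K y ∈ D c J :=
  Subring.le_topologicalClosure _ ⟨y, hy, rfl⟩

theorem incl_mem_range_seriesHom {y : E K} (hy : y ∈ polyRing c J) :
    incl K y ∈ (seriesHom c hj).range := by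
  have hzRing (r : zRing c J) : incl K r ∈ (seriesHom c hj).range := ⟨_, seriesHom_C c hj r⟩
  have hz : incl K (z c j) ∈ (seriesHom c hj).range := hzRing ⟨_, z_mem_zRing c hj⟩
  have ht : incl K (t c j) ∈ (seriesHom c hj).range := ⟨_, seriesHom_X c hj⟩
  have hK (a : K) : incl K (algebraMap K (E K) a) ∈ (seriesHom c hj).range :=
    hzRing (algebraMap K _ a)
  induction hy using Algebra.adjoin_induction with
  | mem y hy =>
    obtain ⟨k, hk, rfl⟩ | rfl | rfl := hy
    · exact hzRing ⟨_, z_mem_zRing c hk⟩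
    · rw [algebraMap_X_zero c j, map_mul, map_add, map_mul, map_one]
      exact mul_mem ht (add_mem (one_mem _) (mul_mem (hK _) hz))
    · rw [algebraMap_X_one c j, map_mul]
      exact mul_mem ht hz
  | algebraMap a => exact hK a
  | add _ _ _ _ hx hy => exact map_add (incl K) _ _ ▸ add_mem hx hy
  | mul _ _ _ _ hx hy => exact map_mul (incl K) _ _ ▸ mul_mem hx hy

theorem D_eq_range_seriesHom : D c J = (seriesHom c hj).range := by
  refine le_antisymm (Subring.topologicalClosure_minimal _ ?_
    (isClosed_range_seriesHom c hj)) ?_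
  · rintro _ ⟨y, hy, rfl⟩
    exact incl_mem_range_seriesHom c hj hy
  · rintro _ ⟨F, rfl⟩
    refine powerSeries_mem_topologicalClosure (valued_seriesHom_X c hj)
      (valued_seriesHom_le_one c hj) (fun r => ?_) ?_ F
    · rw [seriesHom_C]
      exact ⟨r, Algebra.adjoin_mono Set.subset_union_left r.2, rfl⟩
    · rw [seriesHom_X]
      exact ⟨_, t_mem_polyRing c J j, rfl⟩

/-- Substitution of `t = X - c_j Y` into a power series over `K`, with values in `E`; its range is
`K[[t]]`. -/
def powerSeriesHom (j : ι) : K⟦X⟧ →+* E K :=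
  (algebraMap (MvPowerSeries (Fin 2) K) (E K)).comp
    (PowerSeries.substAlgHom (R := K) (hasSubst_tSeries c j)).toRingHom

theorem powerSeriesHom_X : powerSeriesHom c j PowerSeries.X = t c j :=
  congrArg (algebraMap _ (E K)) (PowerSeries.substAlgHom_X (R := K) (hasSubst_tSeries c j))

theorem powerSeriesHom_C (a : K) : powerSeriesHom c j (PowerSeries.C a) = algebraMap K (E K) a :=
  (congrArg _ ((PowerSeries.substAlgHom (hasSubst_tSeries c j)).commutes a)).trans
    (IsScalarTower.algebraMap_apply K (MvPowerSeries (Fin 2) K) (E K) a).symm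

theorem incl_powerSeriesHom (p : K⟦X⟧) : incl K (powerSeriesHom c j p) =
    seriesHom c hj (PowerSeries.map (algebraMap K (zRing c J)) p) := by
  refine RingHom.congr_fun (f := (incl K).comp (powerSeriesHom c j)) (g := (seriesHom c hj).comp
    (PowerSeries.map (algebraMap K (zRing c J)))) (powerSeries_ringHom_ext ?_ ?_ ?_ ?_ ?_) p
  · intro a
    simp [seriesHom_C, powerSeriesHom_C]
  · simp [seriesHom_X, powerSeriesHom_X]
  · simp [powerSeriesHom_X, valued_incl_t]
  · exact fun F => (valued_incl _).trans_le (v_algebraMap_le_one _)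
  · exact fun F => valued_seriesHom_le_one c hj _

theorem exists_incl_eq_seriesHom {n : ℕ} {F : (zRing c J)⟦X⟧}
    (hF : ∀ k, PowerSeries.coeff k F ∈ valuesDegreeLT (evalZ c hj) n) :
    ∃ p ∈ Algebra.adjoin (powerSeriesRing c j) {z c j}, incl K p = seriesHom c hj F := by
  obtain ⟨p, rfl⟩ := exists_eq_sum_map_mul_C_pow _ hF
  refine ⟨∑ l ∈ Finset.range n, powerSeriesHom c j (p l) * z c j ^ l, ?_, ?_⟩
  · refine sum_mem fun l _ => mul_mem ?_ (pow_mem (Algebra.self_mem_adjoin_singleton _ _) l)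
    exact Subalgebra.algebraMap_mem _ (⟨_, p l, rfl⟩ : powerSeriesRing c j)
  · simp only [map_sum, map_mul, map_pow, incl_powerSeriesHom c hj, seriesHom_C, coe_evalZ, aeval_X]

end PowerSeriesOverZRing

section WeierstrassTheorems

theorem mem_adjoin_inv_singleton_iff {L : Type*} [Field L] {S : Subring L} {a : L} (haS : a ∈ S)
    (ha : a ≠ 0) {x : L} : x ∈ Algebra.adjoin S {a⁻¹} ↔ ∃ n : ℕ, a ^ n * x ∈ S := by
  constructor
  · intro hx
    induction hx using Algebra.adjoin_induction with
    | mem x hx =>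
      obtain rfl : x = a⁻¹ := hx
      exact ⟨1, by simp [ha]⟩
    | algebraMap r => exact ⟨0, by rw [pow_zero, one_mul]; exact r.2⟩
    | add x y _ _ hx hy =>
      obtain ⟨n, hn⟩ := hx
      obtain ⟨m, hm⟩ := hy
      refine ⟨n + m, ?_⟩
      convert add_mem (mul_mem (pow_mem haS m) hn) (mul_mem (pow_mem haS n) hm) using 1
      ring
    | mul x y _ _ hx hy =>
      obtain ⟨n, hn⟩ := hx
      obtain ⟨m, hm⟩ := hy
      refine ⟨n + m, ?_⟩
      convert mul_mem hn hm using 1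
      ring
  · rintro ⟨n, hn⟩
    have hx : x = algebraMap S L ⟨_, hn⟩ * a⁻¹ ^ n := by
      change x = a ^ n * x * a⁻¹ ^ n
      rw [inv_pow, mul_comm, inv_mul_cancel_left₀ (pow_ne_zero n ha)]
    rw [hx]
    exact mul_mem (Subalgebra.algebraMap_mem _ _)
      (pow_mem (Algebra.self_mem_adjoin_singleton _ _) n)

variable {K : Type*} [Field K] {ι : Type*} (c : ι → K) {J : Set ι} {j : ι}

theorem algebraMap_coe_mem_polyRing (J : Set ι) (p : MvPolynomial (Fin 2) K) :
    algebraMap (MvPowerSeries (Fin 2) K) (E K) p ∈ polyRing c J := by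
  rw [algebraMap_coe_eq_aeval]
  refine Algebra.adjoin_le (Set.range_subset_iff.2 (algebraMap_X_mem_polyRing c J)) ?_
  rw [Algebra.adjoin_range_eq_range_aeval]
  exact ⟨p, rfl⟩

theorem incl_algebraMap_mem_D (J : Set ι) (f : MvPowerSeries (Fin 2) K) :
    incl K (algebraMap _ (E K) f) ∈ D c J := by
  refine (mem_closure_iff_le_exp (valued_incl_algebraMap_X (K := K) 0)).2 fun n => ?_
  refine ⟨_, ⟨_, algebraMap_coe_mem_polyRing c J (f.truncTotal n), rfl⟩, ?_⟩
  change Valued.v (_ - incl K _) ≤ _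
  rw [← map_sub, ← map_sub, valued_incl, v_algebraMap_le_exp_iff]
  refine MvPowerSeries.nat_le_order fun d hd => ?_
  rw [map_sub, MvPolynomial.coeff_coe, MvPowerSeries.coeff_truncTotal _ hd, sub_self]

theorem mem_DInv_iff {x : Ehat K} : x ∈ DInv c J j ↔ ∃ n : ℕ, incl K (t c j) ^ n * x ∈ D c J :=
  mem_adjoin_inv_singleton_iff (incl_mem_D c (t_mem_polyRing c J j)) (incl_t_ne_zero c j)

theorem D_subset_DInv : (D c J : Set (Ehat K)) ⊆ DInv c J j :=
  fun x hx => (DInv c J j).algebraMap_mem ⟨x, hx⟩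

theorem powerSeriesRing_le_laurentField : powerSeriesRing c j ≤ (laurentField c j).toSubring :=
  Subfield.subset_closure

theorem t_mem_powerSeriesRing : t c j ∈ powerSeriesRing c j :=
  ⟨PowerSeries.X, powerSeriesHom_X c⟩

theorem t_mem_adjoin_powerSeriesRing :
    t c j ∈ Algebra.adjoin (powerSeriesRing c j) {z c j} :=
  Subalgebra.algebraMap_mem _ (⟨_, t_mem_powerSeriesRing c⟩ : powerSeriesRing c j)

theorem exists_t_pow_mul_mem_powerSeriesRing {x : E K} (hx : x ∈ laurentField c j) :
    ∃ n : ℕ, t c j ^ n * x ∈ powerSeriesRing c j := by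
  rw [laurentField, Subfield.mem_closure_iff, Subring.closure_eq] at hx
  obtain ⟨_, ⟨p, rfl⟩, _, ⟨q, rfl⟩, rfl⟩ := hx
  change ∃ n : ℕ, t c j ^ n * (powerSeriesHom c j p / powerSeriesHom c j q) ∈ _
  obtain rfl | hq := eq_or_ne q 0
  · exact ⟨0, by simp⟩
  obtain ⟨s, hs⟩ : ∃ s, q * s = PowerSeries.X ^ q.order.toNat := by
    refine ⟨PowerSeries.Inv_divided_by_X_pow_order hq, ?_⟩
    nth_rw 1 [← PowerSeries.X_pow_order_mul_divXPowOrder (f := q)]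
    rw [mul_assoc, PowerSeries.Inv_divided_by_X_pow_order_rightInv, mul_one]
  have hqs : powerSeriesHom c j q * powerSeriesHom c j s = t c j ^ q.order.toNat := by
    rw [← map_mul, hs, map_pow, powerSeriesHom_X]
  have hq0 : powerSeriesHom c j q ≠ 0 :=
    left_ne_zero_of_mul (hqs ▸ pow_ne_zero _ (t_ne_zero c j))
  refine ⟨q.order.toNat, p * s, (map_mul (powerSeriesHom c j) p s).trans ?_⟩
  rw [← hqs]
  field_simp

theorem adjoin_powerSeriesRing_subset (hj : j ∈ J) :
    (Algebra.adjoin (powerSeriesRing c j) {z c j} : Set (E K)) ⊆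
      Algebra.adjoin (laurentField c j) (z c '' J) := by
  intro p hp
  induction hp using Algebra.adjoin_induction with
  | mem x hx =>
    obtain rfl : x = z c j := hx
    exact Algebra.subset_adjoin ⟨j, hj, rfl⟩
  | algebraMap r =>
    exact Subalgebra.algebraMap_mem _
      (⟨r, powerSeriesRing_le_laurentField c r.2⟩ : laurentField c j)
  | add x y _ _ hx hy => exact add_mem hx hy
  | mul x y _ _ hx hy => exact mul_mem hx hy

theorem t_inv_mem_adjoin_laurentField :
    (t c j)⁻¹ ∈ Algebra.adjoin (laurentField c j) (z c '' J) :=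
  Subalgebra.algebraMap_mem _ (⟨_, inv_mem (powerSeriesRing_le_laurentField c
    (t_mem_powerSeriesRing c))⟩ : laurentField c j)

theorem incl_mem_DInv_of_mem_adjoin {x : E K}
    (hx : x ∈ Algebra.adjoin (laurentField c j) (z c '' J)) : incl K x ∈ DInv c J j := by
  induction hx using Algebra.adjoin_induction with
  | mem x hx =>
    exact D_subset_DInv c
      (incl_mem_D c (Algebra.adjoin_mono Set.subset_union_left (Algebra.subset_adjoin hx)))
  | algebraMap r =>
    obtain ⟨n, p, hp⟩ := exists_t_pow_mul_mem_powerSeriesRing c r.2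
    have htr : incl K (t c j ^ n * (r : E K)) ∈ D c J := hp ▸ incl_algebraMap_mem_D c J _
    refine (mem_DInv_iff c).2 ⟨n, ?_⟩
    rwa [map_mul, map_pow] at htr
  | add x y _ _ hx hy => exact map_add (incl K) x y ▸ add_mem hx hy
  | mul x y _ _ hx hy => exact map_mul (incl K) x y ▸ mul_mem hx hy

variable (hj : j ∈ J)

theorem exists_eq_t_pow_mul_seriesHom {f : Ehat K} (hf : f ∈ D c J) (hf0 : f ≠ 0) :
    ∃ (m : ℕ) (G : (zRing c J)⟦X⟧), PowerSeries.constantCoeff G ≠ 0 ∧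
      f = incl K (t c j) ^ m * seriesHom c hj G := by
  rw [D_eq_range_seriesHom c hj] at hf
  obtain ⟨F, rfl⟩ := hf
  have hF : F ≠ 0 := fun h => hf0 (by rw [h, map_zero])
  refine ⟨F.order.toNat, F.divXPowOrder,
    mt PowerSeries.constantCoeff_divXPowOrder_eq_zero_iff.1 hF, ?_⟩
  rw [← seriesHom_X c hj, ← map_pow, ← map_mul, PowerSeries.X_pow_order_mul_divXPowOrder]

theorem exists_seriesHom_eq_incl_add_mul {G : (zRing c J)⟦X⟧}
    (hG : PowerSeries.constantCoeff G ≠ 0) (F : (zRing c J)⟦X⟧) :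
    ∃ p ∈ Algebra.adjoin (powerSeriesRing c j) {z c j}, ∃ H,
      seriesHom c hj F = incl K p + seriesHom c hj G * seriesHom c hj H := by
  obtain ⟨n, -, hdiv⟩ :=
    exists_associated_forall_eq_add_mul _ (exists_isUnit_mul_evalZ_eq c hj) hG
  obtain ⟨P, H, hP, rfl⟩ := exists_coeff_mem_add_mul _ G hdiv F
  obtain ⟨p, hp, hpP⟩ := exists_incl_eq_seriesHom c hj hP
  exact ⟨p, hp, H, by rw [hpP, map_add, map_mul]⟩

theorem exists_unit_seriesHom_mul_eq_incl {G : (zRing c J)⟦X⟧}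
    (hG : PowerSeries.constantCoeff G ≠ 0) :
    ∃ p ∈ Algebra.adjoin (powerSeriesRing c j) {z c j}, ∃ U : (zRing c J)⟦X⟧ˣ,
      seriesHom c hj (G * U) = incl K p := by
  obtain ⟨n, ⟨_, hp, hGp⟩, hdiv⟩ :=
    exists_associated_forall_eq_add_mul _ (exists_isUnit_mul_evalZ_eq c hj) hG
  obtain ⟨U, hU⟩ := exists_unit_coeff_mul_mem _ G hp hGp hdiv
  obtain ⟨p, hp, hpU⟩ := exists_incl_eq_seriesHom c hj hU
  exact ⟨p, hp, U, hpU.symm⟩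

include hj in
theorem exists_eq_incl_mul_unit {f : Ehat K} (hf : f ∈ D c J) :
    ∃ p ∈ Algebra.adjoin (powerSeriesRing c j) {z c j}, ∃ u : (D c J)ˣ,
      f = incl K p * ((u : D c J) : Ehat K) := by
  obtain rfl | hf0 := eq_or_ne f 0
  · exact ⟨0, zero_mem _, 1, by simp⟩
  obtain ⟨m, G, hG, rfl⟩ := exists_eq_t_pow_mul_seriesHom c hj hf hf0
  obtain ⟨p, hp, U, hU⟩ := exists_unit_seriesHom_mul_eq_incl c hj hG
  let φ : (zRing c J)⟦X⟧ →+* D c J := (seriesHom c hj).codRestrict (D c J) fun F => by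
    rw [D_eq_range_seriesHom c hj]
    exact ⟨F, rfl⟩
  refine ⟨t c j ^ m * p, mul_mem (pow_mem (t_mem_adjoin_powerSeriesRing c) m) hp,
    Units.map φ U⁻¹, ?_⟩
  change _ = _ * seriesHom c hj ↑U⁻¹
  rw [map_mul, map_pow, ← hU, mul_assoc, ← map_mul, Units.mul_inv_cancel_right]

include hj in
theorem DInv_eq_image_adjoin_add_smul {g : Ehat K} (hg : g ∈ D c J) (hg0 : g ≠ 0) :
    (DInv c J j : Set (Ehat K)) =
      incl K '' (Algebra.adjoin (laurentField c j) (z c '' J) : Set (E K)) +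
        g • (DInv c J j : Set (Ehat K)) := by
  have ht := incl_t_ne_zero c j
  refine Set.Subset.antisymm (fun x hx => ?_) ?_
  · obtain ⟨n, hn⟩ := (mem_DInv_iff c).1 hx
    obtain ⟨F, hF⟩ := D_eq_range_seriesHom c hj ▸ hn
    obtain ⟨m, G, hG, rfl⟩ := exists_eq_t_pow_mul_seriesHom c hj hg hg0
    obtain ⟨p, hp, H, hFp⟩ := exists_seriesHom_eq_incl_add_mul c hj hG F
    have hx : x = incl K (p * (t c j)⁻¹ ^ n) + incl K (t c j) ^ m * seriesHom c hj G *
        (seriesHom c hj H * (incl K (t c j))⁻¹ ^ (n + m)) := by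
      refine mul_left_cancel₀ (pow_ne_zero n ht) ?_
      rw [← hF, hFp, map_mul, map_pow, map_inv₀, inv_pow, inv_pow, pow_add]
      field_simp
    have hH : seriesHom c hj H * (incl K (t c j))⁻¹ ^ (n + m) ∈ DInv c J j :=
      mul_mem (D_subset_DInv c (D_eq_range_seriesHom c hj ▸ ⟨H, rfl⟩))
        (pow_mem (Algebra.self_mem_adjoin_singleton _ _) _)
    rw [hx]
    exact Set.add_mem_add ⟨_, mul_mem (adjoin_powerSeriesRing_subset c hj hp)
      (pow_mem (t_inv_mem_adjoin_laurentField c) n), rfl⟩ (Set.smul_mem_smul_set hH)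
  · rintro _ ⟨_, ⟨a, ha, rfl⟩, _, ⟨b, hb, rfl⟩, rfl⟩
    exact add_mem (incl_mem_DInv_of_mem_adjoin c ha) (mul_mem (D_subset_DInv c hg) hb)

end WeierstrassTheorems

section FieldQ

theorem exists_mul_mem_of_mem_range_sup {A F L : Type*} [CommRing A] [Nontrivial A]
    [NoZeroDivisors A] [Field F] [Algebra A F] [IsFractionRing A F] [CommRing L] {φ : F →+* L}
    {S : Subring L}
    (hS : ∀ a, φ (algebraMap A F a) ∈ S) {x : L} (hx : x ∈ φ.range ⊔ S) :
    ∃ b : A, b ≠ 0 ∧ φ (algebraMap A F b) * x ∈ S := by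
  rw [← Subring.closure_eq φ.range, ← Subring.closure_eq S, ← Subring.closure_union] at hx
  induction hx using Subring.closure_induction with
  | mem x hx =>
    obtain ⟨e, rfl⟩ | hx := hx
    · obtain ⟨a, b, hb, rfl⟩ := IsFractionRing.div_surjective (A := A) e
      refine ⟨b, nonZeroDivisors.ne_zero hb, ?_⟩
      rw [← map_mul,
        mul_div_cancel₀ _ (IsFractionRing.to_map_ne_zero_of_mem_nonZeroDivisors hb)]
      exact hS a
    · exact ⟨1, one_ne_zero, by simpa using hx⟩
  | zero => exact ⟨1, one_ne_zero, by simp⟩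
  | one => exact ⟨1, one_ne_zero, by simp⟩
  | neg x _ hx =>
    obtain ⟨a, ha, hax⟩ := hx
    exact ⟨a, ha, by simpa using hax⟩
  | add x y _ _ hx hy =>
    obtain ⟨a, ha, hax⟩ := hx
    obtain ⟨b, hb, hby⟩ := hy
    refine ⟨a * b, mul_ne_zero ha hb, ?_⟩
    convert add_mem (mul_mem (hS b) hax) (mul_mem (hS a) hby) using 1
    rw [map_mul, map_mul]
    ring
  | mul x y _ _ hx hy =>
    obtain ⟨a, ha, hax⟩ := hx
    obtain ⟨b, hb, hby⟩ := hy
    refine ⟨a * b, mul_ne_zero ha hb, ?_⟩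
    convert mul_mem hax hby using 1
    rw [map_mul, map_mul]
    ring

variable {K : Type*} [Field K] {ι : Type*} (c : ι → K)

theorem D_empty_le_range : D c ∅ ≤ (incl K).range := by
  let Ψ : MvPowerSeries (Fin 2) K →+* Ehat K := (incl K).comp (algebraMap _ (E K))
  have hpoly : polyRing c ∅ ≤
      (IsScalarTower.toAlgHom K (MvPowerSeries (Fin 2) K) (E K)).range := by
    refine Algebra.adjoin_le ?_
    rintro _ (⟨_, h, -⟩ | rfl | rfl)
    exacts [h.elim, ⟨_, rfl⟩, ⟨_, rfl⟩]
  have hclosed : IsClosed (Ψ.range : Set (Ehat K)) :=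
    isClosed_range_of_le_exp_iff (Ψ := Ψ.toAddMonoidHom)
      (valued_incl_algebraMap_X (K := K) 0) fun F n => by
        rw [← v_algebraMap_le_exp_iff, ← valued_incl]
        rfl
  refine (Subring.topologicalClosure_minimal _ (t := Ψ.range) ?_ hclosed).trans ?_
  · rintro _ ⟨y, hy, rfl⟩
    obtain ⟨f, rfl⟩ := hpoly hy
    exact ⟨f, rfl⟩
  · rintro _ ⟨f, rfl⟩
    exact ⟨_, rfl⟩

theorem incl_mem_Q (j : ι) (e : E K) : incl K e ∈ Q c j :=
  le_sup_left (b := D c {j}ᶜ) (⟨e, rfl⟩ : incl K e ∈ (incl K).range)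

theorem inv_mem_Q_of_mem_D {j : ι} {x : Ehat K} (hx : x ∈ D c {j}ᶜ) : x⁻¹ ∈ Q c j := by
  obtain h | ⟨k, hk⟩ := ({j}ᶜ : Set ι).eq_empty_or_nonempty
  · obtain ⟨e, rfl⟩ := D_empty_le_range c (h ▸ hx)
    exact map_inv₀ (incl K) e ▸ incl_mem_Q c j _
  · obtain ⟨p, -, u, rfl⟩ := exists_eq_incl_mul_unit c hk hx
    have hu : ((u : D c {j}ᶜ) : Ehat K)⁻¹ = ((u⁻¹ : (D c {j}ᶜ)ˣ) : D c {j}ᶜ) :=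
      inv_eq_of_mul_eq_one_right (congrArg Subtype.val u.mul_inv)
    rw [mul_inv, ← map_inv₀, hu]
    exact mul_mem (incl_mem_Q c j _) (le_sup_right (a := (incl K).range) (Subtype.property _))

theorem inv_mem_Q {j : ι} {x : Ehat K} (hx : x ∈ Q c j) : x⁻¹ ∈ Q c j := by
  obtain ⟨b, hb, hbx⟩ := exists_mul_mem_of_mem_range_sup (incl_algebraMap_mem_D c {j}ᶜ) hx
  have hb0 : incl K (algebraMap _ (E K) b) ≠ 0 := by simpa using hb
  rw [← mul_inv_cancel_left₀ hb0 x⁻¹, ← mul_inv]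
  exact mul_mem (incl_mem_Q c j _) (inv_mem_Q_of_mem_D c hbx)

theorem isField_Q (j : ι) : IsField (Q c j) where
  exists_pair_ne := ⟨0, 1, zero_ne_one⟩
  mul_comm := mul_comm
  mul_inv_cancel {a} ha := ⟨⟨_, inv_mem_Q c a.2⟩,
    Subtype.ext (mul_inv_cancel₀ fun h => ha (Subtype.ext h))⟩

end FieldQ

end AnalyticRings

end

theorem corollary1p12_general {K : Type*} [Field K] {ι : Type*} (c : ι → K) (J : Set ι) (j : ι)
    (hj : j ∈ J) :
    (∀ g ∈ AnalyticRings.D c J, g ≠ 0 →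
      (AnalyticRings.DInv c J j : Set (AnalyticRings.Ehat K)) =
        AnalyticRings.incl K '' (Algebra.adjoin (AnalyticRings.laurentField c j)
            (AnalyticRings.z c '' J) : Set (AnalyticRings.E K)) +
          g • (AnalyticRings.DInv c J j : Set (AnalyticRings.Ehat K))) ∧
    (∀ f ∈ AnalyticRings.D c J,
      ∃ p ∈ Algebra.adjoin (AnalyticRings.powerSeriesRing c j) {AnalyticRings.z c j},
        ∃ u : (AnalyticRings.D c J)ˣ,
          f = AnalyticRings.incl K p * ((u : AnalyticRings.D c J) : AnalyticRings.Ehat K)) ∧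
    IsField (AnalyticRings.Q c j) :=
  ⟨fun _ hg hg0 => AnalyticRings.DInv_eq_image_adjoin_add_smul c hj hg hg0,
    fun _ hf => AnalyticRings.exists_eq_incl_mul_unit c hj hf, AnalyticRings.isField_Q c j⟩

theorem corollary1p12 {K : Type*} [Field K] [Infinite K] {ι : Type*} [Finite ι]
    (c : ι → K) (hc : Function.Injective c) (J : Set ι) (j : ι) (hj : j ∈ J) :
    (∀ g ∈ AnalyticRings.D c J, g ≠ 0 →
      (AnalyticRings.DInv c J j : Set (AnalyticRings.Ehat K)) =
        AnalyticRings.incl K '' (Algebra.adjoin (AnalyticRings.laurentField c j)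
            (AnalyticRings.z c '' J) : Set (AnalyticRings.E K)) +
          g • (AnalyticRings.DInv c J j : Set (AnalyticRings.Ehat K))) ∧
    (∀ f ∈ AnalyticRings.D c J,
      ∃ p ∈ Algebra.adjoin (AnalyticRings.powerSeriesRing c j) {AnalyticRings.z c j},
        ∃ u : (AnalyticRings.D c J)ˣ,
          f = AnalyticRings.incl K p * ((u : AnalyticRings.D c J) : AnalyticRings.Ehat K)) ∧
    IsField (AnalyticRings.Q c j) := by
  exact corollary1p12_general c J j hj
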